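/- Let $k$ be a regular ring (commutative, Noetherian, all of whose localizations at primes are regular local rings) of Krull dimension at most two, and let $G$ be a smooth affine group scheme over $k$ with connected geometric fibres. For a commutative ring $R$ and an affine group scheme $H$ over $R$, an $H$-module is an $R$-module $M$ with a comodule map $M\to M\otimes_R R[H]$; if $M$ is finitely generated and projective over $R$, the dual $M^*=\operatorname{Hom}_R(M,R)$ carries the contragredient action and the symmetric powers $S^d(M^*)$ the induced one. An element $f\in S^d(M^*)$ is evaluated at a point $v\in M\otimes_R F$, for a field $F$ that is an $R$-algebra, as a homogeneous polynomial function, with value $f(v)\in F$. We say that $H$ is *strongly geometrically reductive over $R$* if for every $H$-module $M$ that is finitely generated and projective over $R$, every $R$-algebra $F$ that is a field, and every nonzero $v\in (M\otimes_R F)^{H_F}$, there exist a positive integer $d$ and $f\in S^d(M^*)^{H}$ such that $f(v)\neq 0$. If $G$ is strongly geometrically reductive over $k$, then for every prime ideal $\mathfrak p$ of $k$ the base change $G_{k_{\mathfrak p}}$ is strongly geometrically reductive over $k_{\mathfrak p}$. -/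

import Mathlib

open scoped TensorProduct

universe u

noncomputable section

namespace AffineGroup

/-! Throughout, an affine group scheme `G` over a commutative ring `k` is given by its coordinate
ring `A = k[G]`, a commutative Hopf algebra over `k`. Its base change to a `k`-algebra `K` is given
by the Hopf algebra `K ⊗[k] A` over `K`. -/

section Comodule

variable {k A V : Type*} [CommRing k] [CommRing A] [HopfAlgebra k A] [AddCommGroup V] [Module k V]

/-- `ρ : V → V ⊗ k[G]` is the comodule map of a `G`-module structure on `V`: it is coassociative
and counital. The element `g ∈ G(B) = Hom(k[G], B)` acts on `V ⊗ B` by `v ⊗ 1 ↦ (id ⊗ g)(ρ v)`. -/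
structure IsGModule (ρ : V →ₗ[k] V ⊗[k] A) : Prop where
  coassoc : (TensorProduct.assoc k V A A).toLinearMap ∘ₗ ρ.rTensor A ∘ₗ ρ =
    (Coalgebra.comul (R := k) (A := A)).lTensor V ∘ₗ ρ
  counit : (TensorProduct.rid k V).toLinearMap ∘ₗ
    (Coalgebra.counit (R := k) (A := A)).lTensor V ∘ₗ ρ = LinearMap.id

/-- The invariants `V^G = {v | ρ v = v ⊗ 1}`. -/
def invariants (ρ : V →ₗ[k] V ⊗[k] A) : Submodule k V :=
  LinearMap.eqLocus ρ ((TensorProduct.mk k V A).flip 1)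

/-- The comodule map of the `G_K`-module `K ⊗ V`: the base change of `ρ`, followed by the canonical
isomorphism `K ⊗ (V ⊗ A) ≃ (K ⊗ V) ⊗_K (K ⊗ A)`. -/
def baseChangeCoaction (K : Type*) [CommRing K] [Algebra k K] (ρ : V →ₗ[k] V ⊗[k] A) :
    K ⊗[k] V →ₗ[K] (K ⊗[k] V) ⊗[K] (K ⊗[k] A) :=
  (TensorProduct.AlgebraTensorModule.distribBaseChange k K V A).toLinearMap ∘ₗ ρ.baseChange K

/-- The contragredient comodule map on the dual of a finitely generated projective `G`-module,
i.e. the action `(g f)(v) = f (g⁻¹ v)`. Under the isomorphism `V* ⊗ A ≃ Hom(V, A)` it sends `f` to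
`v ↦ ∑ f(v₀) S(v₁)`, where `ρ v = ∑ v₀ ⊗ v₁` and `S` is the antipode. -/
def dualCoaction [Module.Finite k V] [Module.Projective k V] (ρ : V →ₗ[k] V ⊗[k] A) :
    Module.Dual k V →ₗ[k] Module.Dual k V ⊗[k] A :=
  (dualTensorHomEquiv k V A).symm.toLinearMap ∘ₗ
    LinearMap.lcomp k A ((HopfAlgebra.antipode k (A := A)).lTensor V ∘ₗ ρ) ∘ₗ
    LinearMap.compRight k (TensorProduct.lid k A).toLinearMap ∘ₗ
    LinearMap.rTensorHom A

/-- The comodule map on the symmetric algebra of a `G`-module, where `G` acts by algebra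
automorphisms extending its action on `V`. -/
def symCoaction (ρ : V →ₗ[k] V ⊗[k] A) :
    SymmetricAlgebra k V →ₐ[k] SymmetricAlgebra k V ⊗[k] A :=
  SymmetricAlgebra.lift ((SymmetricAlgebra.ι k V).rTensor A ∘ₗ ρ)

end Comodule

section Polynomial

variable (k : Type*) [CommRing k] (V : Type*) [AddCommGroup V] [Module k V]

/-- The symmetric power `S^d(V)`, the degree `d` part of the symmetric algebra. -/
def symPower (d : ℕ) : Submodule k (SymmetricAlgebra k V) :=
  LinearMap.range (SymmetricAlgebra.ι k V) ^ d

variable {k V}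

/-- The value `f(v) ∈ K` at a point `v ∈ K ⊗ V` of a polynomial function `f ∈ Sym(V*)`: the algebra
homomorphism that sends a linear form `φ ∈ V*` to `(id_K ⊗ φ)(v) ∈ K`. -/
def evalPoly {K : Type*} [CommRing K] [Algebra k K] (v : K ⊗[k] V) :
    SymmetricAlgebra k (Module.Dual k V) →ₐ[k] K :=
  SymmetricAlgebra.lift
    ((TensorProduct.rid k K).toLinearMap ∘ₗ LinearMap.applyₗ v ∘ₗ LinearMap.lTensorHom K)

end Polynomial

/-- All geometric fibres of `G` are connected. -/
def HasConnectedGeometricFibres (k A : Type u) [CommRing k] [CommRing A] [Algebra k A] : Prop :=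
  ∀ (K : Type u) [Field K] [IsAlgClosed K] [Algebra k K], ConnectedSpace (PrimeSpectrum (K ⊗[k] A))

/-- Strong geometric reductivity of `G` over `k`: for every `G`-module `M` that is finitely
generated and projective over `k`, every field `F` over `k` and every nonzero
`v ∈ (M ⊗ F)^{G_F}`, there are `d > 0` and `f ∈ S^d(M*)^G` with `f(v) ≠ 0`. -/
def StronglyGeometricallyReductive (k A : Type u) [CommRing k] [CommRing A] [HopfAlgebra k A] :
    Prop :=
  ∀ (M : Type u) [AddCommGroup M] [Module k M] [Module.Finite k M] [Module.Projective k M]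
    (ρ : M →ₗ[k] M ⊗[k] A), IsGModule ρ →
  ∀ (F : Type u) [Field F] [Algebra k F] (v : F ⊗[k] M),
    v ∈ invariants (baseChangeCoaction F ρ) → v ≠ 0 →
  ∃ d : ℕ, 0 < d ∧ ∃ f ∈ symPower k (Module.Dual k M) d,
    f ∈ invariants (symCoaction (dualCoaction ρ)).toLinearMap ∧ evalPoly v f ≠ 0

end AffineGroup

end

/-! A `G`-module `M` over the local ring `K` of `k` at `p`, finitely generated and projective, is
the localization of a `G`-module `N` over `k` that is finitely generated and projective. Granting
this, an invariant vector of `F ⊗_K M = F ⊗_k N` is detected by an invariant in `S^d(N*)`, whose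
scalar extension to `S^d(M*)` is invariant and takes the same value
(`AffineGroup.StronglyGeometricallyReductive.baseChange`).

To find `N`, regard `M` as a comodule over `A = k[G]`, choose a `K`-basis of `M`, let `W` be its
`k`-span and let `N = {m | ρ m ∈ W ⊗ A}` (`AffineGroup.largestSubmodule`). Since `A` is smooth, it
is flat, and Serre's argument shows that `N` is the largest `G`-submodule of `M` contained in `W`;
it is finitely generated because `k` is Noetherian. Clearing denominators in `ρ m` shows that `N`
localizes to `M`.

The dimension of `k` enters in the projectivity of `N`
(`AffineGroup.projective_largestSubmodule_span_basis`). Locally at a maximal ideal `k` is a domain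
whose maximal ideal is principal, where torsion-free modules cause no difficulty, or generated by a
regular sequence `x`, `y`. In the second case, `x`, `y` is (weakly) regular on `W`, whose
localization is free or zero, so locally `M / W` has no nonzero element killed by `x` and `y`. By flatness
neither does `(M / W) ⊗ A`. As `N` is the kernel of a map to this module, `x`, `y` is regular on
`N`, which forces `𝔪 ⊗ N → N` to be injective and `N` to be free.
Localization is handled through elements: a property holds at `q` when it holds after multiplication
by some `s ∉ q`. -/

/-! ### Regular local rings of dimension at most two -/

section LocalRing

open IsLocalRing

variable {R : Type*} [CommRing R] [IsLocalRing R] [IsNoetherianRing R]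

/-- Modulo `x` the maximal ideal is principal, so a nonmaximal prime containing `x` vanishes modulo
`x`: an element `a x + b y` of `P` has `b ∈ P`, and Nakayama's lemma applies. -/
theorem Ideal.IsPrime.eq_span_singleton_of_maximalIdeal_eq_span_pair {x y : R}
    (hm : maximalIdeal R = Ideal.span {x, y}) {P : Ideal R} (hP : P.IsPrime)
    (hPm : P ≠ maximalIdeal R) (hx : x ∈ P) : P = Ideal.span {x} := by
  have hxP : Ideal.span {x} ≤ P := (Ideal.span_singleton_le_iff_mem P).2 hx
  have hy : y ∉ P := fun hy ↦ hPm <| le_antisymm (le_maximalIdeal hP.ne_top) <| by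
    rw [hm, Ideal.span_le]
    rintro z (rfl | rfl) <;> assumption
  have hym : y ∈ maximalIdeal R := hm ▸ Ideal.subset_span (by simp)
  refine le_antisymm (Submodule.le_of_le_smul_of_le_jacobson_bot (I := maximalIdeal R)
    (IsNoetherian.noetherian P) (IsLocalRing.maximalIdeal_le_jacobson _) fun p hp ↦ ?_) hxP
  obtain ⟨a, b, rfl⟩ := Ideal.mem_span_pair.1 (hm ▸ le_maximalIdeal hP.ne_top hp)
  have hb : b ∈ P := (hP.mem_or_mem ((Submodule.add_mem_iff_right P
    (P.mul_mem_left a hx)).1 hp)).resolve_right hy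
  refine Submodule.add_mem_sup (Ideal.mul_mem_left _ _ (Ideal.mem_span_singleton_self x)) ?_
  rw [mul_comm]
  exact Submodule.smul_mem_smul hym hb

/-- An element `a x` of `P` has `a ∈ P`, so `P = x P` vanishes by Nakayama's lemma. -/
theorem Ideal.IsPrime.eq_bot_of_le_span_singleton {x : R} (hxm : x ∈ maximalIdeal R)
    {P : Ideal R} (hP : P.IsPrime) (hPx : P ≤ Ideal.span {x}) (hx : x ∉ P) : P = ⊥ := by
  refine Submodule.eq_bot_of_le_smul_of_le_jacobson_bot (maximalIdeal R) P
    (IsNoetherian.noetherian P) (fun p hp ↦ ?_) (IsLocalRing.maximalIdeal_le_jacobson _)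
  obtain ⟨a, rfl⟩ := Ideal.mem_span_singleton'.1 (hPx hp)
  rw [mul_comm]
  exact Submodule.smul_mem_smul hxm ((hP.mem_or_mem hp).resolve_right hx)

theorem IsLocalRing.isPrime_bot_of_maximalIdeal_eq_span_singleton {x : R}
    (hm : maximalIdeal R = Ideal.span {x}) {P : Ideal R} (hP : P.IsPrime)
    (hPm : P < maximalIdeal R) : (⊥ : Ideal R).IsPrime := by
  have hx : x ∉ P := fun hx ↦ hPm.not_ge (hm ▸ (Ideal.span_singleton_le_iff_mem P).2 hx)
  rwa [← hP.eq_bot_of_le_span_singleton (hm ▸ Ideal.mem_span_singleton_self x) (hm ▸ hPm.le) hx]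

/-- If the maximal ideal is generated by `x` and `y` and there is a chain of primes of length two,
then the ring is a domain and `x`, `y` is a regular sequence. By Krull's principal ideal theorem a
minimal prime `P'` over `P + (x)` is not maximal, so that `P' = (x)` and then `P = 0`. -/
theorem IsLocalRing.isPrime_of_maximalIdeal_eq_span_pair {x y : R}
    (hm : maximalIdeal R = Ideal.span {x, y}) {P Q : Ideal R} (hP : P.IsPrime) (hQ : Q.IsPrime)
    (hPQ : P < Q) (hQm : Q < maximalIdeal R) :
    (⊥ : Ideal R).IsPrime ∧ (Ideal.span {x}).IsPrime ∧ x ≠ 0 ∧ y ∉ Ideal.span {x} := by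
  have hxm : x ∈ maximalIdeal R := hm ▸ Ideal.subset_span (by simp)
  have hxP : x ∉ P := fun hx ↦ hPQ.ne <|
    (hP.eq_span_singleton_of_maximalIdeal_eq_span_pair hm (hPQ.trans hQm).ne hx).trans
      (hQ.eq_span_singleton_of_maximalIdeal_eq_span_pair hm hQm.ne (hPQ.le hx)).symm
  have hle : P ⊔ Ideal.span {x} ≤ maximalIdeal R :=
    sup_le (le_maximalIdeal hP.ne_top) ((Ideal.span_singleton_le_iff_mem _).2 hxm)
  obtain ⟨P', hP', -⟩ := Ideal.exists_minimalPrimes_le hle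
  have hP'p : P'.IsPrime := hP'.1.1
  have hPP' : P ≤ P' := le_sup_left.trans hP'.1.2
  have hxP' : x ∈ P' := hP'.1.2 (Ideal.mem_sup_right (Ideal.mem_span_singleton_self x))
  have hne : P' ≠ maximalIdeal R := by
    -- otherwise the images of `P < Q < 𝔪` in `R / P` give a chain of length two below an ideal of
    -- height at most one
    rintro rfl
    have h1 := Ideal.map_height_le_one_of_mem_minimalPrimes hP'
    have hs := Ideal.Quotient.mk_surjective (I := P)
    have hk : RingHom.ker (Ideal.Quotient.mk P) = P := Ideal.mk_ker
    have hQ' : (Q.map (Ideal.Quotient.mk P)).IsPrime :=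
      Ideal.map_isPrime_of_surjective hs (hk.le.trans hPQ.le)
    have hm' : ((maximalIdeal R).map (Ideal.Quotient.mk P)).IsPrime :=
      Ideal.map_isPrime_of_surjective hs (hk.le.trans hPP')
    have hlt1 : Q.map (Ideal.Quotient.mk P) < (maximalIdeal R).map (Ideal.Quotient.mk P) := by
      refine lt_of_le_of_ne (Ideal.map_mono hQm.le) fun h ↦ hQm.ne ?_
      have := congrArg (Ideal.comap (Ideal.Quotient.mk P)) h
      rwa [Ideal.comap_map_of_surjective' _ hs, Ideal.comap_map_of_surjective' _ hs, hk,
        sup_eq_left.2 hPQ.le, sup_eq_left.2 hPP'] at this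
    have hlt0 : ⊥ < Q.map (Ideal.Quotient.mk P) := by
      refine bot_lt_iff_ne_bot.2 fun h ↦ hPQ.not_ge ?_
      rw [Ideal.map_eq_bot_iff_le_ker, hk] at h
      exact h
    have hPd : (⊥ : Ideal (R ⧸ P)).IsPrime := by
      have := (Ideal.Quotient.isDomain_iff_prime P).2 hP
      exact Ideal.isPrime_bot
    have e1 := Ideal.height_add_one_le_of_lt_of_isPrime hlt1
    have e0 := Ideal.height_add_one_le_of_lt_of_isPrime hlt0
    have : (1 : ℕ∞) + 1 ≤ 1 :=
      (add_le_add_left ((le_add_left le_rfl).trans e0) 1).trans (e1.trans h1)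
    exact absurd this (by decide)
  have hP'x := hP'p.eq_span_singleton_of_maximalIdeal_eq_span_pair hm hne hxP'
  have hPbot := hP.eq_bot_of_le_span_singleton hxm (hP'x ▸ hPP') hxP
  refine ⟨hPbot ▸ hP, hP'x ▸ hP'p, fun h ↦ hxP (h ▸ P.zero_mem), fun hy ↦ hne ?_⟩
  rw [hP'x, hm, Ideal.span_insert, sup_eq_left.2]
  exact (Ideal.span_singleton_le_iff_mem _).2 hy

end LocalRing

/-- A regular local ring of dimension at most two is a domain whose maximal ideal is principal (this
includes the zero ideal) or generated by a regular sequence `x`, `y`. -/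
theorem IsRegularLocalRing.maximalIdeal_eq_span_of_dim_le_two {R : Type*} [CommRing R]
    [IsRegularLocalRing R] (hdim : ringKrullDim R ≤ 2) :
    IsDomain R ∧ ((∃ x, IsLocalRing.maximalIdeal R = Ideal.span {x}) ∨
      ∃ x y, IsLocalRing.maximalIdeal R = Ideal.span {x, y} ∧ x ≠ 0 ∧
        ∀ a b, y * a = x * b → x ∣ a) := by
  have hd := IsRegularLocalRing.spanFinrank_maximalIdeal (R := R)
  have hfg : (IsLocalRing.maximalIdeal R).FG := IsNoetherian.noetherian _
  have dom : (⊥ : Ideal R).IsPrime → IsDomain R := fun h ↦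
    IsDomain.of_bot_isPrime R
  have h2 : (IsLocalRing.maximalIdeal R).spanFinrank ≤ 2 := by
    rw [← hd] at hdim; exact_mod_cast hdim
  have hmax (P : PrimeSpectrum R) : P.asIdeal ≤ IsLocalRing.maximalIdeal R :=
    IsLocalRing.le_maximalIdeal P.2.ne_top
  obtain ⟨s, hsc, hs⟩ := Submodule.FG.exists_span_set_encard_eq_spanFinrank hfg
  have chain := (Order.le_krullDim_iff (α := PrimeSpectrum R)
    (n := (IsLocalRing.maximalIdeal R).spanFinrank)).1 hd.le
  interval_cases hn : (IsLocalRing.maximalIdeal R).spanFinrank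
  · have : IsLocalRing.maximalIdeal R = ⊥ := by
      simpa using (Submodule.spanFinrank_eq_zero_iff_eq_bot hfg).1 hn
    exact ⟨dom (this ▸ inferInstance), .inl ⟨0, by simpa using this⟩⟩
  · obtain ⟨x, rfl⟩ := Set.encard_eq_one.1 (by simpa using hsc)
    obtain ⟨l, hl⟩ := chain
    have hlt : l ⟨0, by omega⟩ < l ⟨1, by omega⟩ := l.strictMono (Fin.mk_lt_mk.2 one_pos)
    exact ⟨dom (IsLocalRing.isPrime_bot_of_maximalIdeal_eq_span_singleton hs.symm (l _).2
      (lt_of_lt_of_le hlt (hmax _))), .inl ⟨x, hs.symm⟩⟩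
  · obtain ⟨x, y, -, rfl⟩ := Set.encard_eq_two.1 (by simpa using hsc)
    obtain ⟨l, hl⟩ := chain
    have h01 : l ⟨0, by omega⟩ < l ⟨1, by omega⟩ := l.strictMono (Fin.mk_lt_mk.2 one_pos)
    have h12 : l ⟨1, by omega⟩ < l ⟨2, by omega⟩ := l.strictMono (Fin.mk_lt_mk.2 one_lt_two)
    obtain ⟨h0, h1, hx, hy⟩ := IsLocalRing.isPrime_of_maximalIdeal_eq_span_pair hs.symm
      (l _).2 (l _).2 h01 (lt_of_lt_of_le h12 (hmax _))
    refine ⟨dom h0, .inr ⟨x, y, hs.symm, hx, fun a b hab ↦ ?_⟩⟩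
    rw [← Ideal.mem_span_singleton]
    exact (h1.mem_or_mem (hab ▸ Ideal.mul_mem_right _ _ (Ideal.mem_span_singleton_self x) :
      y * a ∈ Ideal.span {x})).resolve_left hy

/-! ### Freeness over a local ring from a regular sequence of generators -/

section Free

open IsLocalRing

variable {R N : Type*} [CommRing R] [IsLocalRing R] [AddCommGroup N] [Module R N]
  [Module.FinitePresentation R N]

/-- If `𝔪 = (x)` and `x` is zero or a nonzerodivisor on `N`, then `𝔪 ⊗ N → N` is injective. -/
theorem Module.free_of_maximalIdeal_eq_span_singleton {x : R}
    (hm : maximalIdeal R = Ideal.span {x}) (hx : ∀ n : N, x • n = 0 → x = 0 ∨ n = 0) :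
    Module.Free R N := by
  refine Module.free_of_maximalIdeal_rTensor_injective
    ((injective_iff_map_eq_zero _).2 fun t ht ↦ ?_)
  have hxm : x ∈ maximalIdeal R := hm ▸ Ideal.mem_span_singleton_self x
  obtain ⟨n, rfl⟩ : ∃ n : N, t = (⟨x, hxm⟩ : maximalIdeal R) ⊗ₜ[R] n := by
    clear ht
    induction t with
    | zero => exact ⟨0, by simp⟩
    | tmul r n =>
      obtain ⟨r, hr⟩ := r
      obtain ⟨a, rfl⟩ := Ideal.mem_span_singleton'.1 (hm ▸ hr)
      exact ⟨a • n, by rw [← TensorProduct.smul_tmul]; rfl⟩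
    | add t t' h h' =>
      obtain ⟨n, rfl⟩ := h
      obtain ⟨n', rfl⟩ := h'
      exact ⟨n + n', by rw [TensorProduct.tmul_add]⟩
  have h0 : x • n = 0 := by simpa using congrArg (TensorProduct.lid R N) ht
  rcases hx n h0 with rfl | rfl
  · exact TensorProduct.zero_tmul _ _
  · exact TensorProduct.tmul_zero _ _

/-- If `𝔪 = (x, y)` for a regular sequence on `N`, then `𝔪 ⊗ N → N` is injective: a relation
`x a + y b = 0` forces `b = x c` and `a = -y c`, and `x ⊗ y c = y ⊗ x c` in `𝔪 ⊗ N`. -/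
theorem Module.free_of_maximalIdeal_eq_span_pair {x y : R}
    (hm : maximalIdeal R = Ideal.span {x, y}) (hx : ∀ n : N, x • n = 0 → n = 0)
    (hxy : ∀ n n' : N, y • n = x • n' → ∃ c, n = x • c) : Module.Free R N := by
  refine Module.free_of_maximalIdeal_rTensor_injective
    ((injective_iff_map_eq_zero _).2 fun t ht ↦ ?_)
  have hxm : x ∈ maximalIdeal R := hm ▸ Ideal.subset_span (by simp)
  have hym : y ∈ maximalIdeal R := hm ▸ Ideal.subset_span (by simp)
  obtain ⟨a, b, rfl⟩ : ∃ a b : N, t = (⟨x, hxm⟩ : maximalIdeal R) ⊗ₜ[R] a +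
      (⟨y, hym⟩ : maximalIdeal R) ⊗ₜ[R] b := by
    clear ht
    induction t with
    | zero => exact ⟨0, 0, by simp⟩
    | tmul r n =>
      obtain ⟨r, hr⟩ := r
      obtain ⟨a, b, rfl⟩ := Ideal.mem_span_pair.1 (hm ▸ hr)
      exact ⟨a • n, b • n, by rw [← TensorProduct.smul_tmul, ← TensorProduct.smul_tmul,
        ← TensorProduct.add_tmul]; rfl⟩
    | add t t' h h' =>
      obtain ⟨a, b, rfl⟩ := h
      obtain ⟨a', b', rfl⟩ := h'
      exact ⟨a + a', b + b', by rw [TensorProduct.tmul_add, TensorProduct.tmul_add]; abel⟩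
  have h0 : x • a + y • b = 0 := by simpa using congrArg (TensorProduct.lid R N) ht
  obtain ⟨c, rfl⟩ := hxy b (-a) (by rw [smul_neg]; exact (neg_eq_of_add_eq_zero_right h0).symm)
  obtain rfl : a = -(y • c) := by
    rw [← add_eq_zero_iff_eq_neg]
    apply hx
    rw [smul_add, smul_comm x y, h0]
  rw [TensorProduct.tmul_neg, ← TensorProduct.smul_tmul, ← TensorProduct.smul_tmul,
    neg_add_eq_zero]
  congr 1
  exact Subtype.ext (mul_comm y x)

end Free

/-! ### Subcomodules over a flat Hopf algebra -/

namespace AffineGroup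

section Subcomodule

variable {k A M : Type*} [CommRing k] [CommRing A] [HopfAlgebra k A] [AddCommGroup M] [Module k M]

/-- The elements `m` of a `G`-module `M` with `ρ m` in the image of `W ⊗ A`. If `A` is flat, this is
the largest `G`-submodule of `M` that is contained in `W`. -/
noncomputable def largestSubmodule (ρ : M →ₗ[k] M ⊗[k] A) (W : Submodule k M) : Submodule k M :=
  LinearMap.ker (W.mkQ.rTensor A ∘ₗ ρ)

variable {ρ : M →ₗ[k] M ⊗[k] A} {W : Submodule k M}

theorem mem_largestSubmodule {m : M} :
    m ∈ largestSubmodule ρ W ↔ W.mkQ.rTensor A (ρ m) = 0 := Iff.rfl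

/-- By right exactness of `⊗`, the definition agrees with the description through `W ⊗ A`. -/
theorem mem_largestSubmodule_iff_mem_range {m : M} :
    m ∈ largestSubmodule ρ W ↔ ρ m ∈ LinearMap.range (W.subtype.rTensor A) :=
  rTensor_exact A (LinearMap.exact_subtype_mkQ W) W.mkQ_surjective (ρ m)

/-- Applying the counit to `ρ m ∈ W ⊗ A` recovers `m`. -/
theorem largestSubmodule_le (hρ : IsGModule ρ) : largestSubmodule ρ W ≤ W := by
  intro m hm
  obtain ⟨t, ht⟩ := mem_largestSubmodule_iff_mem_range.1 hm
  have h := LinearMap.congr_fun hρ.counit m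
  simp only [LinearMap.comp_apply, LinearMap.id_apply, ← ht] at h
  rw [← h]
  clear h ht
  induction t with
  | zero => simp
  | add a b ha hb => simpa using W.add_mem ha hb
  | tmul w a => simpa using W.smul_mem _ w.2

/-- `largestSubmodule ρ W` is a `G`-submodule. Flatness of `A` identifies its tensor product with
`A` with the kernel of the map that defines it, tensored with `A`. -/
theorem coaction_mem_range_of_mem_largestSubmodule [Module.Flat k A] (hρ : IsGModule ρ) {m : M}
    (hm : m ∈ largestSubmodule ρ W) :
    ρ m ∈ LinearMap.range ((largestSubmodule ρ W).subtype.rTensor A) := by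
  have hex : Function.Exact (largestSubmodule ρ W).subtype (W.mkQ.rTensor A ∘ₗ ρ) :=
    LinearMap.exact_subtype_ker_map _
  refine (Module.Flat.rTensor_exact A hex (ρ m)).1 ?_
  -- by coassociativity, `(ρ ⊗ id) (ρ m)` depends on `ρ m` through `id ⊗ Δ`, which commutes
  -- with the projection to `M / W`
  have h := LinearMap.congr_fun hρ.coassoc m
  simp only [LinearMap.comp_apply, LinearEquiv.coe_coe] at h
  rw [← LinearEquiv.eq_symm_apply] at h
  rw [LinearMap.rTensor_comp_apply, h]
  have nat (t : M ⊗[k] (A ⊗[k] A)) : (W.mkQ.rTensor A).rTensor A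
      ((TensorProduct.assoc k M A A).symm t) =
      (TensorProduct.assoc k (M ⧸ W) A A).symm (W.mkQ.rTensor (A ⊗[k] A) t) := by
    have : (W.mkQ.rTensor A).rTensor A ∘ₗ (TensorProduct.assoc k M A A).symm.toLinearMap =
        (TensorProduct.assoc k (M ⧸ W) A A).symm.toLinearMap ∘ₗ W.mkQ.rTensor (A ⊗[k] A) := by
      ext; simp
    exact LinearMap.congr_fun this t
  rw [nat, ← LinearMap.comp_apply (LinearMap.rTensor _ _), LinearMap.rTensor_comp_lTensor,
    ← LinearMap.lTensor_comp_rTensor, LinearMap.comp_apply, mem_largestSubmodule.1 hm,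
    map_zero, map_zero]

/-- A submodule that `ρ` maps to the image of `N ⊗ A` is a `G`-module, by injectivity of
`N ⊗ A → M ⊗ A`. -/
theorem exists_subcoaction [Module.Flat k A] (hρ : IsGModule ρ) {N : Submodule k M}
    (hN : ∀ m ∈ N, ρ m ∈ LinearMap.range (N.subtype.rTensor A)) :
    ∃ σ : N →ₗ[k] N ⊗[k] A, IsGModule σ ∧ N.subtype.rTensor A ∘ₗ σ = ρ ∘ₗ N.subtype := by
  have inj : Function.Injective (N.subtype.rTensor A) :=
    Module.Flat.rTensor_preserves_injective_linearMap _ N.injective_subtype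
  let σ : N →ₗ[k] N ⊗[k] A := (LinearEquiv.ofInjective _ inj).symm.toLinearMap ∘ₗ
    LinearMap.codRestrict _ (ρ ∘ₗ N.subtype) fun n ↦ hN n n.2
  have hσ : N.subtype.rTensor A ∘ₗ σ = ρ ∘ₗ N.subtype := by
    ext n
    exact congrArg Subtype.val ((LinearEquiv.ofInjective _ inj).apply_symm_apply _)
  have hσ' (n : N) : N.subtype.rTensor A (σ n) = ρ n := LinearMap.congr_fun hσ n
  refine ⟨σ, ⟨?_, ?_⟩, hσ⟩
  · have inj' : Function.Injective (N.subtype.rTensor (A ⊗[k] A)) :=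
      Module.Flat.rTensor_preserves_injective_linearMap _ N.injective_subtype
    ext n
    apply inj'
    have h := LinearMap.congr_fun hρ.coassoc n
    simp only [LinearMap.comp_apply, LinearEquiv.coe_coe] at h ⊢
    have nat : N.subtype.rTensor (A ⊗[k] A) ∘ₗ (TensorProduct.assoc k N A A).toLinearMap =
        (TensorProduct.assoc k M A A).toLinearMap ∘ₗ (N.subtype.rTensor A).rTensor A := by
      ext; simp
    rw [← LinearEquiv.coe_coe, ← LinearMap.comp_apply, nat, LinearMap.comp_apply,
      ← LinearMap.rTensor_comp_apply, hσ, LinearMap.rTensor_comp_apply, hσ', LinearEquiv.coe_coe, h,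
      ← LinearMap.comp_apply (LinearMap.rTensor _ _), LinearMap.rTensor_comp_lTensor,
      ← LinearMap.lTensor_comp_rTensor, LinearMap.comp_apply, hσ']
  · ext n
    have h := LinearMap.congr_fun hρ.counit n
    simp only [LinearMap.comp_apply, LinearEquiv.coe_coe, LinearMap.id_apply] at h ⊢
    rw [← h, ← hσ']
    generalize σ n = t
    induction t with
    | zero => simp
    | add a b ha hb => simp [ha, hb]
    | tmul w a => simp

end Subcomodule

/-! ### Restriction of scalars for comodules -/

section RestrictScalars

variable {k A K M : Type*} [CommRing k] [CommRing A] [HopfAlgebra k A] [CommRing K] [Algebra k K]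
  [AddCommGroup M] [Module k M] [Module K M] [IsScalarTower k K M]

/-- The `G`-module over `k` that underlies a `G_K`-module: its comodule map under the identification
`M ⊗_K (K ⊗ A) ≃ M ⊗ A`. -/
noncomputable def restrictCoaction (ρ : M →ₗ[K] M ⊗[K] (K ⊗[k] A)) : M →ₗ[k] M ⊗[k] A :=
  ((TensorProduct.AlgebraTensorModule.cancelBaseChange k K K M A).toLinearMap ∘ₗ
    ρ).restrictScalars k

variable {ρ : M →ₗ[K] M ⊗[K] (K ⊗[k] A)}

theorem restrictCoaction_apply (m : M) : restrictCoaction ρ m =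
    TensorProduct.AlgebraTensorModule.cancelBaseChange k K K M A (ρ m) := rfl

theorem IsGModule.restrictCoaction (hρ : IsGModule ρ) : IsGModule (restrictCoaction ρ) := by
  constructor
  · let c := TensorProduct.AlgebraTensorModule.cancelBaseChange k K K M A
    -- the canonical map `M ⊗_K (K ⊗ A) ⊗_K (K ⊗ A) → M ⊗ (A ⊗ A)`
    let d : M ⊗[K] ((K ⊗[k] A) ⊗[K] (K ⊗[k] A)) →ₗ[K] M ⊗[k] (A ⊗[k] A) :=
      (TensorProduct.AlgebraTensorModule.cancelBaseChange k K K M (A ⊗[k] A)).toLinearMap ∘ₗ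
        (TensorProduct.AlgebraTensorModule.distribBaseChange k K A A).symm.toLinearMap.lTensor M
    ext m
    have h := congrArg d (LinearMap.congr_fun hρ.coassoc m)
    simp only [LinearMap.comp_apply, LinearEquiv.coe_coe] at h ⊢
    have h1 (t : M ⊗[K] (K ⊗[k] A)) : d (TensorProduct.assoc K M _ _ (ρ.rTensor (K ⊗[k] A) t)) =
        TensorProduct.assoc k M A A ((AffineGroup.restrictCoaction ρ).rTensor A (c t)) := by
      have h2 (z : M ⊗[K] (K ⊗[k] A)) (b : K) (a : A) :
          d (TensorProduct.assoc K M _ _ (z ⊗ₜ[K] (b ⊗ₜ[k] a))) =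
          TensorProduct.assoc k M A A (c (b • z) ⊗ₜ[k] a) := by
        induction z with
        | zero => simp
        | add x y hx hy => simp only [TensorProduct.add_tmul, map_add, hx, hy, smul_add]
        | tmul m w =>
          induction w with
          | zero => simp
          | add x y hx hy =>
            simp only [TensorProduct.tmul_add, TensorProduct.add_tmul, map_add, hx, hy, smul_add]
          | tmul b' a' => simp [d, c, TensorProduct.smul_tmul', smul_smul, mul_comm]
      induction t with
      | zero => simp
      | add x y hx hy => simp only [map_add, hx, hy]
      | tmul m w =>
        induction w with
        | zero => simp
        | add x y hx hy => simp only [TensorProduct.tmul_add, map_add, hx, hy]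
        | tmul b a =>
          rw [LinearMap.rTensor_tmul, h2]
          simp [c, restrictCoaction_apply]
    have h3 (t : M ⊗[K] (K ⊗[k] A)) :
        d ((Coalgebra.comul (R := K) (A := K ⊗[k] A)).lTensor M t) =
        (Coalgebra.comul (R := k) (A := A)).lTensor M (c t) := by
      induction t with
      | zero => simp
      | add x y hx hy => simp only [map_add, hx, hy]
      | tmul m w =>
        induction w with
        | zero => simp
        | add x y hx hy => simp only [TensorProduct.tmul_add, map_add, hx, hy]
        | tmul b a =>
          rw [LinearMap.lTensor_tmul, TensorProduct.comul_tmul, CommSemiring.comul_apply,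
            TensorProduct.AlgebraTensorModule.cancelBaseChange_tmul, LinearMap.lTensor_tmul]
          generalize Coalgebra.comul (R := k) a = z
          induction z with
          | zero => simp
          | add x y hx hy => simp only [TensorProduct.tmul_add, map_add, hx, hy]
          | tmul a a' => simp [d]
    rw [h1, h3] at h
    exact h
  · ext m
    have h := LinearMap.congr_fun hρ.counit m
    simp only [LinearMap.comp_apply, LinearEquiv.coe_coe, LinearMap.id_apply] at h ⊢
    rw [restrictCoaction_apply]
    refine Eq.trans ?_ h
    generalize ρ m = t
    induction t with
    | zero => simp
    | add x y hx hy => simp only [map_add, hx, hy]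
    | tmul m w =>
      induction w with
      | zero => simp
      | add x y hx hy => simp only [TensorProduct.tmul_add, map_add, hx, hy]
      | tmul b a =>
        rw [LinearMap.lTensor_tmul, TensorProduct.rid_tmul, TensorProduct.counit_tmul,
          TensorProduct.AlgebraTensorModule.cancelBaseChange_tmul, LinearMap.lTensor_tmul,
          TensorProduct.rid_tmul, CommSemiring.counit_apply, smul_assoc]

end RestrictScalars

end AffineGroup

/-! ### Strong geometric reductivity under base change -/

namespace AffineGroup

section Transfer

variable {k A K M N : Type*} [CommRing k] [CommRing A] [HopfAlgebra k A] [CommRing K] [Algebra k K]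
  [AddCommGroup M] [Module k M] [Module K M] [IsScalarTower k K M] [AddCommGroup N] [Module k N]
  {j : N →ₗ[k] M}

/-- The scalar extension `N* → M*` of linear forms to `M = K ⊗ N`. -/
noncomputable def extendDual (hj : IsBaseChange K j) : Module.Dual k N →ₗ[k] Module.Dual K M where
  toFun φ := hj.lift (Algebra.linearMap k K ∘ₗ φ)
  map_add' φ ψ := hj.algHom_ext _ _ fun n ↦ by simp [hj.lift_eq]
  map_smul' c φ := hj.algHom_ext _ _ fun n ↦ by simp [hj.lift_eq, Algebra.smul_def]

@[simp]
theorem extendDual_apply (hj : IsBaseChange K j) (φ : Module.Dual k N) (n : N) :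
    extendDual hj φ (j n) = algebraMap k K (φ n) := by
  simp [extendDual, hj.lift_eq]

/-- The contragredient comodule map `φ ↦ ∑ φᵢ ⊗ aᵢ` is characterized by
`∑ φᵢ(n) aᵢ = ∑ φ(n₀) S(n₁)`. -/
theorem dualTensorHom_dualCoaction [Module.Finite k N] [Module.Projective k N]
    (σ : N →ₗ[k] N ⊗[k] A) (φ : Module.Dual k N) (n : N) :
    dualTensorHom k N A (dualCoaction σ φ) n =
      TensorProduct.lid k A (φ.rTensor A ((HopfAlgebra.antipode k (A := A)).lTensor N (σ n))) := by
  have : dualTensorHom k N A (dualCoaction σ φ) =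
    dualTensorHomEquiv k N A (dualCoaction σ φ) := rfl
  rw [this, dualCoaction]
  simp only [LinearMap.comp_apply, LinearEquiv.coe_coe, LinearEquiv.apply_symm_apply]
  rfl

variable {ρ : M →ₗ[K] M ⊗[K] (K ⊗[k] A)} {σ : N →ₗ[k] N ⊗[k] A}

theorem coaction_eq_cancelBaseChange_symm (h : restrictCoaction ρ ∘ₗ j = j.rTensor A ∘ₗ σ) (n : N) :
    ρ (j n) = (TensorProduct.AlgebraTensorModule.cancelBaseChange k K K M A).symm
      (j.rTensor A (σ n)) := by
  rw [LinearEquiv.eq_symm_apply]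
  exact LinearMap.congr_fun h n

/-- Scalar extension of linear forms is equivariant for the contragredient actions. -/
theorem dualCoaction_extendDual [Module.Finite k N] [Module.Projective k N] [Module.Finite K M]
    [Module.Projective K M] (hj : IsBaseChange K j)
    (h : restrictCoaction ρ ∘ₗ j = j.rTensor A ∘ₗ σ) (φ : Module.Dual k N) :
    dualCoaction ρ (extendDual hj φ) =
      (TensorProduct.AlgebraTensorModule.cancelBaseChange k K K (Module.Dual K M) A).symm
        ((extendDual hj).rTensor A (dualCoaction σ φ)) := by
  apply (dualTensorHomEquiv K M (K ⊗[k] A)).injective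
  refine hj.algHom_ext _ _ fun n ↦ ?_
  change dualTensorHom K M _ _ _ = dualTensorHom K M _ _ _
  rw [dualTensorHom_dualCoaction, coaction_eq_cancelBaseChange_symm h]
  -- both sides are `1 ⊗ ∑ φ(n₀) S(n₁)`
  have h1 (t : N ⊗[k] A) : TensorProduct.lid K (K ⊗[k] A) ((extendDual hj φ).rTensor _
      ((HopfAlgebra.antipode K (A := K ⊗[k] A)).lTensor M
        ((TensorProduct.AlgebraTensorModule.cancelBaseChange k K K M A).symm
          (j.rTensor A t)))) = 1 ⊗ₜ[k] TensorProduct.lid k A (φ.rTensor A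
            ((HopfAlgebra.antipode k (A := A)).lTensor N t)) := by
    induction t with
    | zero => simp
    | add x y hx hy => simp only [map_add, hx, hy, TensorProduct.tmul_add]
    | tmul n a =>
      simp [Algebra.smul_def]
      rw [← Algebra.smul_def, Algebra.algebraMap_eq_smul_one, TensorProduct.smul_tmul]
  have h2 (t : Module.Dual k N ⊗[k] A) : dualTensorHom K M (K ⊗[k] A)
      ((TensorProduct.AlgebraTensorModule.cancelBaseChange k K K (Module.Dual K M) A).symm
        ((extendDual hj).rTensor A t)) (j n) = 1 ⊗ₜ[k] dualTensorHom k N A t n := by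
    induction t with
    | zero => simp
    | add x y hx hy => simp only [map_add, hx, hy, TensorProduct.tmul_add, LinearMap.add_apply]
    | tmul n a =>
      simp [Algebra.smul_def]
      rw [← Algebra.smul_def, Algebra.algebraMap_eq_smul_one, TensorProduct.smul_tmul]
  rw [h1, h2, dualTensorHom_dualCoaction]

/-- The `k`-algebra homomorphism `Sym(N*) → Sym(M*)` given by scalar extension to `M = K ⊗ N`. -/
noncomputable def symExtendDual (hj : IsBaseChange K j) :
    SymmetricAlgebra k (Module.Dual k N) →ₐ[k] SymmetricAlgebra K (Module.Dual K M) :=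
  SymmetricAlgebra.lift ((SymmetricAlgebra.ι K (Module.Dual K M)).restrictScalars k ∘ₗ
    extendDual hj)

@[simp]
theorem symExtendDual_ι (hj : IsBaseChange K j) (φ : Module.Dual k N) :
    symExtendDual hj (SymmetricAlgebra.ι k _ φ) = SymmetricAlgebra.ι K _ (extendDual hj φ) := by
  simp [symExtendDual]

theorem symExtendDual_mem_symPower (hj : IsBaseChange K j) (d : ℕ)
    {f : SymmetricAlgebra k (Module.Dual k N)} (hf : f ∈ symPower k (Module.Dual k N) d) :
    symExtendDual hj f ∈ symPower K (Module.Dual K M) d := by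
  induction hf using Submodule.pow_induction_on_left' with
  | algebraMap r =>
    rw [AlgHom.commutes, symPower, pow_zero, IsScalarTower.algebraMap_apply k K]
    exact Submodule.algebraMap_mem _
  | add x y i hx hy ihx ihy => rw [map_add]; exact add_mem ihx ihy
  | mem_mul m hm i x hx ih =>
    obtain ⟨φ, rfl⟩ := hm
    rw [map_mul, symExtendDual_ι, symPower, pow_succ']
    exact Submodule.mul_mem_mul (LinearMap.mem_range_self _ _) ih

/-- Scalar extension of polynomial functions is equivariant. -/
theorem symCoaction_symExtendDual [Module.Finite k N] [Module.Projective k N] [Module.Finite K M]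
    [Module.Projective K M] (hj : IsBaseChange K j)
    (h : restrictCoaction ρ ∘ₗ j = j.rTensor A ∘ₗ σ) (f : SymmetricAlgebra k (Module.Dual k N)) :
    symCoaction (dualCoaction ρ) (symExtendDual hj f) =
      (TensorProduct.AlgebraTensorModule.cancelBaseChange k K K
        (SymmetricAlgebra K (Module.Dual K M)) A).symm
        ((symExtendDual hj).toLinearMap.rTensor A (symCoaction (dualCoaction σ) f)) := by
  let S := SymmetricAlgebra K (Module.Dual K M)
  -- the right-hand side is an algebra homomorphism, so it is enough to compare linear forms
  let g : SymmetricAlgebra k (Module.Dual k N) ⊗[k] A →ₐ[k] S ⊗[K] (K ⊗[k] A) :=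
    Algebra.TensorProduct.productMap
      ((Algebra.TensorProduct.includeLeft (R := K) (S := K) (A := S)
        (B := K ⊗[k] A)).restrictScalars k |>.comp (symExtendDual hj))
      ((Algebra.TensorProduct.includeRight (R := K) (A := S) (B := K ⊗[k] A)).restrictScalars k
        |>.comp (Algebra.TensorProduct.includeRight (R := k) (A := K) (B := A)))
  have hg (t) : g t = (TensorProduct.AlgebraTensorModule.cancelBaseChange k K K S A).symm
        ((symExtendDual hj).toLinearMap.rTensor A t) := by
    induction t with
    | zero => simp
    | add x y hx hy => simp only [map_add, hx, hy]
    | tmul x a => simp [g]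
  rw [← hg]
  have key : ((symCoaction (dualCoaction ρ)).restrictScalars k).comp (symExtendDual hj) =
      g.comp (symCoaction (dualCoaction σ)) := by
    apply SymmetricAlgebra.algHom_ext
    refine LinearMap.ext fun φ ↦ ?_
    change symCoaction (dualCoaction ρ) (symExtendDual hj (SymmetricAlgebra.ι k _ φ)) =
      g (symCoaction (dualCoaction σ) (SymmetricAlgebra.ι k _ φ))
    rw [hg, symExtendDual_ι, symCoaction, symCoaction, SymmetricAlgebra.lift_ι_apply,
      SymmetricAlgebra.lift_ι_apply, LinearMap.comp_apply, LinearMap.comp_apply,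
      dualCoaction_extendDual hj h]
    generalize dualCoaction σ φ = t
    induction t with
    | zero => simp
    | add x y hx hy => simp only [map_add, hx, hy]
    | tmul x a => simp
  exact DFunLike.congr_fun key f

theorem symExtendDual_mem_invariants [Module.Finite k N] [Module.Projective k N]
    [Module.Finite K M] [Module.Projective K M] (hj : IsBaseChange K j)
    (h : restrictCoaction ρ ∘ₗ j = j.rTensor A ∘ₗ σ) {f : SymmetricAlgebra k (Module.Dual k N)}
    (hf : f ∈ invariants (symCoaction (dualCoaction σ)).toLinearMap) :
    symExtendDual hj f ∈ invariants (symCoaction (dualCoaction ρ)).toLinearMap := by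
  have hf' : symCoaction (dualCoaction σ) f = f ⊗ₜ[k] 1 := hf
  change symCoaction (dualCoaction ρ) (symExtendDual hj f) = symExtendDual hj f ⊗ₜ[K] 1
  rw [symCoaction_symExtendDual hj h, hf']
  simp [Algebra.TensorProduct.one_def]

variable {F : Type*} [Field F] [Algebra k F] [Algebra K F] [IsScalarTower k K F]

/-- The isomorphism `F ⊗_k N ≃ F ⊗_K M` for `M = K ⊗_k N`. -/
noncomputable def tensorEquiv (F : Type*) [Field F] [Algebra k F] [Algebra K F]
    [IsScalarTower k K F] (hj : IsBaseChange K j) : F ⊗[k] N ≃ₗ[F] F ⊗[K] M :=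
  (TensorProduct.AlgebraTensorModule.cancelBaseChange k K F F N).symm ≪≫ₗ
    TensorProduct.AlgebraTensorModule.congr (LinearEquiv.refl F F) hj.equiv

@[simp]
theorem tensorEquiv_tmul (hj : IsBaseChange K j) (c : F) (n : N) :
    tensorEquiv F hj (c ⊗ₜ[k] n) = c ⊗ₜ[K] j n := by
  simp [tensorEquiv, hj.equiv_tmul]

theorem evalPoly_symExtendDual (hj : IsBaseChange K j) (v : F ⊗[k] N)
    (f : SymmetricAlgebra k (Module.Dual k N)) :
    evalPoly (tensorEquiv F hj v) (symExtendDual hj f) = evalPoly v f := by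
  have key : ((evalPoly (tensorEquiv F hj v)).restrictScalars k).comp (symExtendDual hj) =
      evalPoly v := by
    apply SymmetricAlgebra.algHom_ext
    refine LinearMap.ext fun φ ↦ ?_
    change evalPoly (tensorEquiv F hj v) (symExtendDual hj (SymmetricAlgebra.ι k _ φ)) =
      evalPoly v (SymmetricAlgebra.ι k _ φ)
    rw [symExtendDual_ι, evalPoly, evalPoly, SymmetricAlgebra.lift_ι_apply,
      SymmetricAlgebra.lift_ι_apply]
    change TensorProduct.rid K F ((extendDual hj φ).lTensor F (tensorEquiv F hj v)) =
      TensorProduct.rid k F (φ.lTensor F v)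
    induction v with
    | zero => simp
    | add x y hx hy => simp only [map_add, hx, hy]
    | tmul c n => simp
  exact DFunLike.congr_fun key f

theorem tensorEquiv_mem_invariants_iff (hj : IsBaseChange K j)
    (h : restrictCoaction ρ ∘ₗ j = j.rTensor A ∘ₗ σ) {v : F ⊗[k] N} :
    tensorEquiv F hj v ∈ invariants (baseChangeCoaction F ρ) ↔
      v ∈ invariants (baseChangeCoaction F σ) := by
  let E : (F ⊗[k] N) ⊗[F] (F ⊗[k] A) ≃ₗ[F] (F ⊗[K] M) ⊗[F] (F ⊗[K] (K ⊗[k] A)) :=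
    TensorProduct.congr (tensorEquiv F hj)
      (TensorProduct.AlgebraTensorModule.cancelBaseChange k K F F A).symm
  have hE (v : F ⊗[k] N) : baseChangeCoaction F ρ (tensorEquiv F hj v) =
      E (baseChangeCoaction F σ v) := by
    induction v with
    | zero => simp
    | add x y hx hy => simp only [map_add, hx, hy]
    | tmul c n =>
      simp only [baseChangeCoaction, LinearMap.comp_apply, LinearMap.baseChange_tmul,
        tensorEquiv_tmul, coaction_eq_cancelBaseChange_symm h]
      generalize σ n = t
      induction t with
      | zero => simp
      | add x y hx hy => simp only [TensorProduct.tmul_add, map_add, hx, hy]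
      | tmul n a => simp [E]
  have h1 : E (v ⊗ₜ 1) = tensorEquiv F hj v ⊗ₜ 1 := by
    simp [E, Algebra.TensorProduct.one_def]
  change baseChangeCoaction F ρ (tensorEquiv F hj v) = tensorEquiv F hj v ⊗ₜ 1 ↔
    baseChangeCoaction F σ v = v ⊗ₜ 1
  rw [hE, ← h1, E.injective.eq_iff]

end Transfer

/-- If every `G_K`-module that is finitely generated and projective over `K` is the base change of a
`G`-module that is finitely generated and projective over `k`, then strong geometric reductivity
passes from `G` to `G_K`. -/
theorem StronglyGeometricallyReductive.baseChange {k A K : Type u} [CommRing k] [CommRing A]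
    [HopfAlgebra k A] [CommRing K] [Algebra k K] (hG : StronglyGeometricallyReductive k A)
    (hext : ∀ (M : Type u) [AddCommGroup M] [Module K M] [Module k M] [IsScalarTower k K M]
      [Module.Finite K M] [Module.Projective K M] (ρ : M →ₗ[K] M ⊗[K] (K ⊗[k] A)), IsGModule ρ →
      ∃ (N : Submodule k M) (σ : N →ₗ[k] N ⊗[k] A), Module.Finite k N ∧ Module.Projective k N ∧
        IsGModule σ ∧ IsBaseChange K N.subtype ∧
        restrictCoaction ρ ∘ₗ N.subtype = N.subtype.rTensor A ∘ₗ σ) :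
    StronglyGeometricallyReductive K (K ⊗[k] A) := by
  intro M _ _ _ _ ρ hρ F _ _ v hv hv0
  let _ : Module k M := Module.compHom M (algebraMap k K)
  have : IsScalarTower k K M := IsScalarTower.of_algebraMap_smul fun _ _ ↦ rfl
  let _ : Algebra k F := Algebra.compHom F (algebraMap k K)
  have : IsScalarTower k K F := IsScalarTower.of_algebraMap_eq' rfl
  obtain ⟨N, σ, hfin, hproj, hσ, hj, h⟩ := hext M ρ hρ
  obtain ⟨w, rfl⟩ := (tensorEquiv F hj).surjective v
  obtain ⟨d, hd, f, hf, hfG, hfw⟩ := hG N σ hσ F w ((tensorEquiv_mem_invariants_iff hj h).1 hv)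
    fun h0 ↦ hv0 (by rw [h0, map_zero])
  exact ⟨d, hd, symExtendDual hj f, symExtendDual_mem_symPower hj d hf,
    symExtendDual_mem_invariants hj h hfG, by rwa [evalPoly_symExtendDual]⟩

end AffineGroup

/-! ### Regular sequences up to torsion -/

section Torsion

variable {k : Type*} [CommRing k] {T : Submonoid k}

theorem Submonoid.exists_mem_forall_of_forall_exists_mem {ι : Type*} [Finite ι] {P : ι → k → Prop}
    (hP : ∀ i r s, P i s → P i (r * s)) (h : ∀ i, ∃ s ∈ T, P i s) : ∃ s ∈ T, ∀ i, P i s := by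
  classical
  cases nonempty_fintype ι
  choose s hs hsP using h
  refine ⟨∏ i, s i, T.prod_mem fun i _ ↦ hs i, fun i ↦ ?_⟩
  rw [← Finset.prod_erase_mul _ _ (Finset.mem_univ i)]
  exact hP _ _ _ (hsP i)

variable {M X A : Type*} [AddCommGroup M] [Module k M] [AddCommGroup X] [Module k X]
  [AddCommGroup A] [Module k A]

/-- If elements of `X` that are killed by `x` and `y` are `T`-torsion, then so are such elements of
`X ⊗ A` for a flat module `A`. -/
theorem exists_smul_tensor_eq_zero [Module.Flat k A] {x y : k}
    (hX : ∀ z : X, x • z = 0 → y • z = 0 → ∃ s ∈ T, s • z = 0) (z : X ⊗[k] A)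
    (hx : x • z = 0) (hy : y • z = 0) : ∃ s ∈ T, s • z = 0 := by
  -- impose the two conditions one after the other, so that each is the kernel of one multiplication
  let K₁ : Submodule k X := LinearMap.ker (LinearMap.lsmul k X x)
  let K₂ : Submodule k K₁ := LinearMap.ker (LinearMap.lsmul k K₁ y)
  have hlsmul (Y : Type _) [AddCommGroup Y] [Module k Y] (c : k) (w : Y ⊗[k] A) :
      (LinearMap.lsmul k Y c).rTensor A w = c • w := by
    induction w with
    | zero => simp
    | add a b ha hb => rw [map_add, smul_add, ha, hb]
    | tmul a b => simp [TensorProduct.smul_tmul']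
  have e₁ : Function.Exact (K₁.subtype.rTensor A) ((LinearMap.lsmul k X x).rTensor A) :=
    Module.Flat.rTensor_exact A (LinearMap.exact_subtype_ker_map _)
  have e₂ : Function.Exact (K₂.subtype.rTensor A) ((LinearMap.lsmul k K₁ y).rTensor A) :=
    Module.Flat.rTensor_exact A (LinearMap.exact_subtype_ker_map _)
  obtain ⟨z₁, rfl⟩ := (e₁ z).1 (by rw [hlsmul, hx])
  have inj : Function.Injective (K₁.subtype.rTensor A) :=
    Module.Flat.rTensor_preserves_injective_linearMap _ K₁.injective_subtype
  obtain ⟨z₂, rfl⟩ := (e₂ z₁).1 (by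
    rw [hlsmul]
    apply inj
    rw [map_smul, hy, map_zero])
  clear hx hy
  induction z₂ with
  | zero => exact ⟨1, T.one_mem, by simp⟩
  | add a b ha hb =>
    obtain ⟨s, hs, hsa⟩ := ha
    obtain ⟨t, ht, htb⟩ := hb
    refine ⟨s * t, T.mul_mem hs ht, ?_⟩
    rw [map_add, map_add, smul_add, mul_comm s t, mul_smul t s, hsa, mul_comm t s, mul_smul s t,
      htb, smul_zero, smul_zero, add_zero]
  | tmul c a =>
    obtain ⟨s, hs, hsc⟩ := hX c.1.1 c.1.2 (congrArg Subtype.val c.2)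
    refine ⟨s, hs, ?_⟩
    rw [LinearMap.rTensor_tmul, LinearMap.rTensor_tmul, TensorProduct.smul_tmul']
    change (s • c.1.1) ⊗ₜ[k] a = 0
    rw [hsc, TensorProduct.zero_tmul]

/-- If `x` is a nonzerodivisor on `M` and `y` is a nonzerodivisor on `W / x W`, up to `T`-torsion,
then the elements of `M / W` that are killed by `x` and `y` are `T`-torsion. -/
theorem exists_smul_quotient_eq_zero {W : Submodule k M} {x y : k}
    (hx : ∀ t : M, x • t = 0 → ∃ s ∈ T, s • t = 0)
    (hW : ∀ w₁ ∈ W, ∀ w₂ ∈ W, y • w₁ = x • w₂ → ∃ s ∈ T, ∃ w ∈ W, s • w₁ = x • w)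
    (z : M ⧸ W) (hxz : x • z = 0) (hyz : y • z = 0) : ∃ s ∈ T, s • z = 0 := by
  obtain ⟨t, rfl⟩ := W.mkQ_surjective z
  rw [← map_smul, W.mkQ_apply, Submodule.Quotient.mk_eq_zero] at hxz hyz
  obtain ⟨s, hs, w, hw, hsw⟩ := hW _ hxz _ hyz (smul_comm y x t)
  obtain ⟨s', hs', h⟩ := hx (s • t - w) (by rw [smul_sub, smul_comm x s, hsw, sub_self])
  refine ⟨s' * s, T.mul_mem hs' hs, ?_⟩
  rw [← map_smul, W.mkQ_apply, Submodule.Quotient.mk_eq_zero, mul_smul]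
  rw [smul_sub, sub_eq_zero] at h
  exact h ▸ W.smul_mem s' hw

/-- The kernel of a map `g : M → (M / W) ⊗ A` inherits from `W` the property that `y` is a
nonzerodivisor modulo `x`, up to elements of `T`. -/
theorem exists_smul_eq_smul_of_mem_ker [Module.Flat k A] {W : Submodule k M} {x y : k}
    (hx : ∀ t : M, x • t = 0 → ∃ s ∈ T, s • t = 0)
    (hW : ∀ w₁ ∈ W, ∀ w₂ ∈ W, y • w₁ = x • w₂ → ∃ s ∈ T, ∃ w ∈ W, s • w₁ = x • w)
    (g : M →ₗ[k] (M ⧸ W) ⊗[k] A) (hg : LinearMap.ker g ≤ W) {n₁ n₂ : M}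
    (h₁ : n₁ ∈ LinearMap.ker g) (h₂ : n₂ ∈ LinearMap.ker g) (h : y • n₁ = x • n₂) :
    ∃ s ∈ T, ∃ n ∈ LinearMap.ker g, s • n₁ = x • n := by
  obtain ⟨s, hs, w, hw, hsw⟩ := hW _ (hg h₁) _ (hg h₂) h
  obtain ⟨t, ht, htw⟩ := hx (y • w - s • n₂) (by
    rw [smul_sub, smul_comm x y, ← hsw, smul_comm y s, h, smul_comm x s, sub_self])
  -- `t • w` becomes an element of the kernel after multiplication by `x` or by `y`
  have hxg : x • g (t • w) = 0 := by
    rw [← map_smul, smul_comm, ← hsw, map_smul, map_smul, LinearMap.mem_ker.1 h₁, smul_zero,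
      smul_zero]
  have hyg : y • g (t • w) = 0 := by
    rw [smul_sub, sub_eq_zero] at htw
    rw [← map_smul, smul_comm, htw, map_smul, map_smul, LinearMap.mem_ker.1 h₂, smul_zero,
      smul_zero]
  obtain ⟨r, hr, hrw⟩ := exists_smul_tensor_eq_zero (exists_smul_quotient_eq_zero hx hW) _ hxg hyg
  refine ⟨r * t * s, T.mul_mem (T.mul_mem hr ht) hs, r • t • w, ?_, ?_⟩
  · rw [LinearMap.mem_ker, map_smul, hrw]
  · rw [mul_smul, mul_smul, hsw, smul_comm t x, smul_comm r x]

end Torsion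

/-! ### Regular sequences on localized modules -/

section Localization

open IsLocalRing

/-- The generators of the maximal ideal of `k_q` can be chosen in `k`, which allows computing with
elements of `k`-modules. -/
theorem IsRegularRing.exists_maximalIdeal_localization_eq_span {k : Type*} [CommRing k]
    [IsRegularRing k] (hdim : ringKrullDim k ≤ 2) (q : Ideal k) [q.IsPrime] :
    IsDomain (Localization.AtPrime q) ∧
    ((∃ x : k, maximalIdeal (Localization.AtPrime q) = Ideal.span {algebraMap k _ x}) ∨
      ∃ x y : k, maximalIdeal (Localization.AtPrime q) =
          Ideal.span {algebraMap k _ x, algebraMap k _ y} ∧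
        algebraMap k (Localization.AtPrime q) x ≠ 0 ∧
        ∀ a b : Localization.AtPrime q, algebraMap k _ y * a = algebraMap k _ x * b →
          algebraMap k _ x ∣ a) := by
  have hd : ringKrullDim (Localization.AtPrime q) ≤ 2 := by
    rw [IsLocalization.AtPrime.ringKrullDim_eq_height q]
    exact (Ideal.height_le_ringKrullDim_of_ne_top (Ideal.IsPrime.ne_top ‹_›)).trans hdim
  have hassoc (x : Localization.AtPrime q) :
      ∃ x₀ : k, Associated (algebraMap k (Localization.AtPrime q) x₀) x := by
    obtain ⟨⟨a, s⟩, h⟩ := IsLocalization.surj q.primeCompl x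
    exact ⟨a, h ▸ (associated_mul_unit_left x _ (IsLocalization.map_units _ s))⟩
  obtain ⟨hdom, h⟩ := IsRegularLocalRing.maximalIdeal_eq_span_of_dim_le_two hd
  refine ⟨hdom, h.imp ?_ ?_⟩
  · rintro ⟨x, hx⟩
    obtain ⟨x₀, h₀⟩ := hassoc x
    exact ⟨x₀, hx.trans (Ideal.span_singleton_eq_span_singleton.2 h₀).symm⟩
  · rintro ⟨x, y, hxy, hx, hreg⟩
    obtain ⟨x₀, h₀⟩ := hassoc x
    obtain ⟨y₀, h₁⟩ := hassoc y
    refine ⟨x₀, y₀, ?_, fun h ↦ hx (h₀.eq_zero_iff.1 h), fun a b hab ↦ ?_⟩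
    · rw [hxy, Ideal.span_insert, Ideal.span_insert, Ideal.span_singleton_eq_span_singleton.2 h₀,
        Ideal.span_singleton_eq_span_singleton.2 h₁]
    · obtain ⟨u, rfl⟩ := h₁
      obtain ⟨v, hv⟩ := h₀.symm
      rw [h₀.dvd_iff_dvd_left]
      have := hreg (↑u⁻¹ * a) (v * b) (by
        rw [mul_assoc, Units.mul_inv_cancel_left, hab, ← mul_assoc, hv])
      exact (Units.dvd_mul_left).1 this

variable {k N : Type*} [CommRing k] [AddCommGroup N] [Module k N] {T : Submonoid k}

theorem LocalizedModule.mk_eq_zero_of_smul_eq_zero {n : N} {s : T} {r : k} (hr : r ∈ T)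
    (h : r • n = 0) : LocalizedModule.mk n s = 0 := by
  rw [← LocalizedModule.zero_mk s, LocalizedModule.mk_eq]
  exact ⟨⟨r, hr⟩, by simp [Submonoid.smul_def, smul_comm r, h]⟩

theorem LocalizedModule.eq_zero_of_algebraMap_smul_eq_zero {x : k}
    (hx : ∀ n : N, x • n = 0 → ∃ s ∈ T, s • n = 0) (ν : LocalizedModule T N)
    (h : algebraMap k (Localization T) x • ν = 0) : ν = 0 := by
  induction ν using LocalizedModule.induction_on with
  | h n s =>
    rw [algebraMap_smul, LocalizedModule.smul'_mk, ← LocalizedModule.zero_mk s,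
      LocalizedModule.mk_eq] at h
    obtain ⟨u, hu⟩ := h
    simp only [Submonoid.smul_def, smul_zero] at hu
    obtain ⟨r, hr, h0⟩ := hx ((u : k) • (s : k) • n) (by
      rw [← hu, smul_comm x, smul_comm x])
    refine mk_eq_zero_of_smul_eq_zero (T.mul_mem hr (T.mul_mem u.2 s.2)) ?_
    rw [mul_smul, mul_smul, h0]

theorem LocalizedModule.exists_eq_algebraMap_smul {x y : k}
    (hxy : ∀ n₁ n₂ : N, y • n₁ = x • n₂ → ∃ s ∈ T, ∃ n : N, s • n₁ = x • n)
    (ν ν' : LocalizedModule T N)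
    (h : algebraMap k (Localization T) y • ν = algebraMap k (Localization T) x • ν') :
    ∃ c, ν = algebraMap k (Localization T) x • c := by
  induction ν, ν' using LocalizedModule.induction_on₂ with
  | h n n' s s' =>
    rw [algebraMap_smul, algebraMap_smul, LocalizedModule.smul'_mk, LocalizedModule.smul'_mk,
      LocalizedModule.mk_eq] at h
    obtain ⟨u, hu⟩ := h
    simp only [Submonoid.smul_def] at hu
    obtain ⟨r, hr, n'', h''⟩ := hxy ((u : k) • (s' : k) • n) ((u : k) • (s : k) • n') (by
      rw [smul_comm y, smul_comm y, hu, smul_comm x (u : k), smul_comm x (s : k)])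
    refine ⟨LocalizedModule.mk n'' (⟨r, hr⟩ * u * s' * s), ?_⟩
    rw [algebraMap_smul, LocalizedModule.smul'_mk, ← h'', LocalizedModule.mk_eq]
    refine ⟨1, ?_⟩
    simp only [Submonoid.smul_def, Submonoid.coe_mul, one_smul, smul_smul]
    ring_nf

end Localization

/-! ### Lattices in modules over a localization -/

section Lattice

variable {k K M ι : Type*} [CommRing k] [CommRing K] [Algebra k K] [AddCommGroup M] [Module k M]
  [Module K M] [IsScalarTower k K M] {S : Submonoid k}

theorem IsLocalizedModule.subtype_of_forall_exists_smul_mem {N : Submodule k M} (K : Type*)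
    [CommRing K] [Algebra k K] [Module K M] [IsScalarTower k K M] [IsLocalization S K]
    (hN : ∀ m : M, ∃ s ∈ S, s • m ∈ N) : IsLocalizedModule S N.subtype where
  map_units s := by
    have h : algebraMap k (Module.End k M) s = Algebra.lsmul k k M (algebraMap k K s) := by
      ext m; simp
    exact h ▸ (IsLocalization.map_units K s).map (Algebra.lsmul k k M)
  surj m := by
    obtain ⟨s, hs, h⟩ := hN m
    exact ⟨⟨⟨s • m, h⟩, ⟨s, hs⟩⟩, rfl⟩
  exists_of_eq h := ⟨1, by rw [Subtype.ext h]⟩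

theorem exists_smul_mem_span_range_basis (S : Submonoid k)
    [IsLocalization S K] [Finite ι] (b : Module.Basis ι K M) (m : M) :
    ∃ s ∈ S, s • m ∈ Submodule.span k (Set.range b) := by
  cases nonempty_fintype ι
  obtain ⟨s, hs⟩ := IsLocalization.exist_integer_multiples_of_finite S fun i ↦ b.repr m i
  refine ⟨s, s.2, ?_⟩
  rw [← b.sum_repr m, Finset.smul_sum]
  refine Submodule.sum_mem _ fun i _ ↦ ?_
  obtain ⟨c, hc⟩ := hs i
  rw [← smul_assoc]
  rw [← hc, algebraMap_smul]
  exact Submodule.smul_mem _ _ (Submodule.subset_span (Set.mem_range_self i))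

/-- An element `x ∈ k` that does not vanish in the domain `k_q` is a nonzerodivisor on the
localization of `M` at `q`. -/
theorem exists_smul_eq_zero_of_basis (S : Submonoid k)
    [IsLocalization S K] [Finite ι] (b : Module.Basis ι K M) (q : Ideal k) [q.IsPrime]
    [IsDomain (Localization.AtPrime q)] {x : k}
    (hx : algebraMap k (Localization.AtPrime q) x ≠ 0) (t : M) (ht : x • t = 0) :
    ∃ s ∈ q.primeCompl, s • t = 0 := by
  have hK (c : K) (hc : x • c = 0) : ∃ s ∈ q.primeCompl, s • c = 0 := by
    obtain ⟨a, u, rfl⟩ := IsLocalization.exists_mk'_eq S c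
    rw [IsLocalization.smul_mk', IsLocalization.mk'_eq_zero_iff] at hc
    obtain ⟨v, hv⟩ := hc
    have h0 : algebraMap k (Localization.AtPrime q) x *
        algebraMap k (Localization.AtPrime q) (v * a) = 0 := by
      rw [← map_mul, mul_left_comm, hv, map_zero]
    obtain ⟨s, hs⟩ := (IsLocalization.map_eq_zero_iff q.primeCompl _ _).1
      ((mul_eq_zero.1 h0).resolve_left hx)
    refine ⟨s, s.2, ?_⟩
    rw [IsLocalization.smul_mk', IsLocalization.mk'_eq_zero_iff]
    exact ⟨v, by rw [mul_left_comm, hs]⟩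
  obtain ⟨s, hs, h⟩ := Submonoid.exists_mem_forall_of_forall_exists_mem (T := q.primeCompl)
    (P := fun i s ↦ s • b.repr t i = 0) (fun i r s h ↦ by rw [mul_smul, h, smul_zero])
    fun i ↦ hK (b.repr t i) (by
      rw [← Finsupp.smul_apply, ← algebraMap_smul K x (b.repr t), ← map_smul, algebraMap_smul, ht,
        map_zero, Finsupp.zero_apply])
  refine ⟨s, hs, b.ext_elem fun i ↦ ?_⟩
  rw [← algebraMap_smul K s t, map_smul, Finsupp.smul_apply, algebraMap_smul, h, map_zero,
    Finsupp.zero_apply]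

/-- If `y` is a nonzerodivisor on `k_q / (x)`, then it is one on `W / x W` localized at `q`, where
`W` is the `k`-span of a basis of `M` over a localization `K` of `k`. -/
theorem exists_smul_eq_smul_of_mem_span_range_basis (S : Submonoid k)
    [IsLocalization S K] [Finite ι] (b : Module.Basis ι K M)
    (q : Ideal k) [q.IsPrime] [IsDomain (Localization.AtPrime q)] {x y : k}
    (hxy : ∀ a c : Localization.AtPrime q, algebraMap k _ y * a = algebraMap k _ x * c →
      algebraMap k _ x ∣ a) (w₁ : M) (h₁ : w₁ ∈ Submodule.span k (Set.range b)) (w₂ : M)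
    (h₂ : w₂ ∈ Submodule.span k (Set.range b)) (h : y • w₁ = x • w₂) :
    ∃ s ∈ q.primeCompl, ∃ w ∈ Submodule.span k (Set.range b), s • w₁ = x • w := by
  cases nonempty_fintype ι
  have hk (a c : k) (hac : algebraMap k K (y * a) = algebraMap k K (x * c)) :
      ∃ s ∈ q.primeCompl, ∃ d, algebraMap k K (s * a) = algebraMap k K (x * d) := by
    obtain ⟨u, hu⟩ := (IsLocalization.eq_iff_exists S K).1 hac
    by_cases hu0 : algebraMap k (Localization.AtPrime q) u = 0
    · -- an element outside of `q` kills `u`, hence becomes zero in `K`, where `u` is invertible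
      obtain ⟨s, hs⟩ := (IsLocalization.map_eq_zero_iff q.primeCompl _ _).1 hu0
      refine ⟨s, s.2, 0, (IsLocalization.eq_iff_exists S K).2 ⟨u, ?_⟩⟩
      rw [mul_zero, mul_zero, ← mul_assoc, mul_comm (u : k), hs, zero_mul]
    · have hu' : algebraMap k (Localization.AtPrime q) y * algebraMap k _ a =
          algebraMap k _ x * algebraMap k _ c := by
        apply mul_left_cancel₀ hu0
        rw [← map_mul, ← map_mul, ← map_mul, ← map_mul, hu]
      obtain ⟨d, hd⟩ := hxy _ _ hu'
      obtain ⟨⟨e, s⟩, hes⟩ := IsLocalization.surj q.primeCompl d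
      have : algebraMap k (Localization.AtPrime q) (s * a) = algebraMap k _ (x * e) := by
        rw [map_mul, map_mul, ← hes, hd]; ring
      obtain ⟨v, hv⟩ := (IsLocalization.eq_iff_exists q.primeCompl _).1 this
      refine ⟨v * s, (v * s).2, v * e, congrArg _ ?_⟩
      rw [mul_assoc, hv]; ring
  obtain ⟨f₁, rfl⟩ := (Submodule.mem_span_range_iff_exists_fun k).1 h₁
  obtain ⟨f₂, rfl⟩ := (Submodule.mem_span_range_iff_exists_fun k).1 h₂
  have hcoord (r : k) (f : ι → k) :
      r • ∑ i, f i • b i = ∑ i, algebraMap k K (r * f i) • b i := by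
    simp only [Finset.smul_sum, algebraMap_smul, mul_smul]
  rw [hcoord, hcoord] at h
  have h' := fun i ↦ b.linearIndependent.eq_coords_of_eq h i
  obtain ⟨s, hs, hsP⟩ := Submonoid.exists_mem_forall_of_forall_exists_mem (T := q.primeCompl)
    (P := fun i s ↦ ∃ d, algebraMap k K (s * f₁ i) = algebraMap k K (x * d))
    (fun i r s ⟨d, hd⟩ ↦ ⟨r * d, by rw [mul_assoc, map_mul, hd, ← map_mul]; congr 1; ring⟩)
    fun i ↦ hk _ _ (h' i)
  choose d hd using hsP
  refine ⟨s, hs, ∑ i, d i • b i, (Submodule.mem_span_range_iff_exists_fun k).2 ⟨d, rfl⟩, ?_⟩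
  rw [hcoord, hcoord]
  exact Finset.sum_congr rfl fun i _ ↦ by rw [hd]

end Lattice

/-! ### Extending representations from a localization -/

namespace AffineGroup

section Extension

variable {k A K M ι : Type*} [CommRing k] [CommRing A] [HopfAlgebra k A] [CommRing K] [Algebra k K]
  [AddCommGroup M] [Module k M] [Module K M] [IsScalarTower k K M] {S : Submonoid k}

/-- If `W` becomes all of `M` after inverting `S`, so does the largest `G`-submodule contained in
`W`: a denominator of `ρ m` with respect to `W ⊗ A` moves `m` into it. -/
theorem exists_smul_mem_largestSubmodule {ρ : M →ₗ[k] M ⊗[k] A} {W : Submodule k M}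
    (hW : ∀ m : M, ∃ s ∈ S, s • m ∈ W) (m : M) : ∃ s ∈ S, s • m ∈ largestSubmodule ρ W := by
  have h (t : M ⊗[k] A) : ∃ s ∈ S, s • W.mkQ.rTensor A t = 0 := by
    induction t with
    | zero => exact ⟨1, S.one_mem, by simp⟩
    | add a b ha hb =>
      obtain ⟨s, hs, hsa⟩ := ha
      obtain ⟨t, ht, htb⟩ := hb
      refine ⟨s * t, S.mul_mem hs ht, ?_⟩
      rw [map_add, smul_add, mul_comm s t, mul_smul t s, hsa, mul_comm t s, mul_smul s t, htb,
        smul_zero, smul_zero, add_zero]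
    | tmul m a =>
      obtain ⟨s, hs, h⟩ := hW m
      refine ⟨s, hs, ?_⟩
      rw [LinearMap.rTensor_tmul, TensorProduct.smul_tmul', ← map_smul, W.mkQ_apply,
        (Submodule.Quotient.mk_eq_zero W).2 h, TensorProduct.zero_tmul]
  obtain ⟨s, hs, h⟩ := h (ρ m)
  exact ⟨s, hs, by rw [mem_largestSubmodule, map_smul, map_smul, h]⟩

/-- The largest `G`-submodule contained in the lattice spanned by a `K`-basis of `M` is projective.
At a maximal ideal generated by `x` and `y`, the elements `x`, `y` form a regular sequence on the
lattice and also on the submodule, which is the kernel of a map from `M` to `(M / W) ⊗ A`. -/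
theorem projective_largestSubmodule_span_basis [IsRegularRing k] (hdim : ringKrullDim k ≤ 2)
    [Module.Flat k A] [IsLocalization S K] [Finite ι] (b : Module.Basis ι K M)
    {ρ : M →ₗ[k] M ⊗[k] A} (hρ : IsGModule ρ) :
    Module.Projective k (largestSubmodule ρ (Submodule.span k (Set.range b))) := by
  set W := Submodule.span k (Set.range b)
  have hle : largestSubmodule ρ W ≤ W := largestSubmodule_le hρ
  have hfin : Module.Finite k (largestSubmodule ρ W) := by
    have : Module.Finite k W := Module.Finite.span_of_finite k (Set.finite_range b)
    exact Module.Finite.of_injective (Submodule.inclusion hle) (Submodule.inclusion_injective hle)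
  have : Module.FinitePresentation k (largestSubmodule ρ W) :=
    Module.finitePresentation_of_finite k _
  refine Module.projective_of_localization_maximal fun q hq ↦ ?_
  have : Module.Finite (Localization.AtPrime q)
      (LocalizedModule q.primeCompl (largestSubmodule ρ W)) :=
    Module.Finite.of_isLocalizedModule q.primeCompl
      (LocalizedModule.mkLinearMap q.primeCompl (largestSubmodule ρ W))
  have : Module.FinitePresentation (Localization.AtPrime q)
      (LocalizedModule q.primeCompl (largestSubmodule ρ W)) :=
    Module.finitePresentation_of_finite _ _
  obtain ⟨hdom, ⟨x, hm⟩ | ⟨x, y, hm, hx, hxy⟩⟩ :=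
    IsRegularRing.exists_maximalIdeal_localization_eq_span hdim q
  all_goals
    have hreg (hx : algebraMap k (Localization.AtPrime q) x ≠ 0)
        (n : largestSubmodule ρ W) (hn : x • n = 0) : ∃ s ∈ q.primeCompl, s • n = 0 := by
      obtain ⟨s, hs, h⟩ := exists_smul_eq_zero_of_basis S b q hx n (congrArg Subtype.val hn)
      exact ⟨s, hs, Subtype.ext h⟩
  · have := Module.free_of_maximalIdeal_eq_span_singleton hm
      (N := LocalizedModule q.primeCompl (largestSubmodule ρ W)) fun ν hν ↦ or_iff_not_imp_left.2
        fun hx ↦ LocalizedModule.eq_zero_of_algebraMap_smul_eq_zero (hreg hx) ν hν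
    infer_instance
  · have := Module.free_of_maximalIdeal_eq_span_pair hm
      (N := LocalizedModule q.primeCompl (largestSubmodule ρ W))
      (LocalizedModule.eq_zero_of_algebraMap_smul_eq_zero (hreg hx))
      (LocalizedModule.exists_eq_algebraMap_smul fun n₁ n₂ h ↦ by
        obtain ⟨s, hs, n, hn, h⟩ := exists_smul_eq_smul_of_mem_ker (T := q.primeCompl)
          (exists_smul_eq_zero_of_basis S b q hx)
          (exists_smul_eq_smul_of_mem_span_range_basis S b q hxy) _ hle n₁.2 n₂.2
          (congrArg Subtype.val h)
        exact ⟨s, hs, ⟨n, hn⟩, Subtype.ext h⟩)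
    infer_instance

end Extension

end AffineGroup

theorem theorem4p9 (k A : Type u) [CommRing k] [IsRegularRing k] (hdim : ringKrullDim k ≤ 2)
    [CommRing A] [HopfAlgebra k A] [Algebra.Smooth k A]
    (hconn : AffineGroup.HasConnectedGeometricFibres k A)
    (hG : AffineGroup.StronglyGeometricallyReductive k A) (p : Ideal k) [p.IsPrime] :
    AffineGroup.StronglyGeometricallyReductive (Localization.AtPrime p)
      (Localization.AtPrime p ⊗[k] A) := by
  refine hG.baseChange fun M _ _ _ _ _ _ ρ hρ ↦ ?_
  have hρ' := hρ.restrictCoaction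
  have : Module.Free (Localization.AtPrime p) M := Module.free_of_flat_of_isLocalRing
  let b := Module.Free.chooseBasis (Localization.AtPrime p) M
  let W := Submodule.span k (Set.range b)
  have hle := AffineGroup.largestSubmodule_le (W := W) hρ'
  obtain ⟨σ, hσ, h⟩ := AffineGroup.exists_subcoaction (A := A) hρ'
    fun m hm ↦ AffineGroup.coaction_mem_range_of_mem_largestSubmodule (W := W) hρ' hm
  refine ⟨_, σ, ?_, AffineGroup.projective_largestSubmodule_span_basis (S := p.primeCompl) hdim b
    hρ', hσ, ?_, h.symm⟩
  · have : Module.Finite k W := Module.Finite.span_of_finite k (Set.finite_range b)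
    exact Module.Finite.of_injective (Submodule.inclusion hle) (Submodule.inclusion_injective hle)
  · rw [← isLocalizedModule_iff_isBaseChange p.primeCompl]
    exact IsLocalizedModule.subtype_of_forall_exists_smul_mem (Localization.AtPrime p)
      (AffineGroup.exists_smul_mem_largestSubmodule
        (exists_smul_mem_span_range_basis p.primeCompl b))
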